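/- Let $(X,\mu)$ be a standard probability space (a standard Borel space with a Borel probability measure) and let $n\in\mathbb N$. For a graph $\mathcal G$ on $X$ let $E_{\mathcal G}$ be the equivalence relation of lying in the same connected component. The graph $\mathcal G$ is called pmp if every Borel bijection $\theta:A\to B$ between Borel sets $A,B\subseteq X$ with $(x,\theta(x))\in E_{\mathcal G}$ for all $x\in A$ satisfies $\mu(\theta^{-1}(C))=\mu(C)$ for all $\mu$-measurable $C\subseteq B$. The approximate measurable chromatic number $\chi^{\mathrm{ap}}_\mu(\mathcal G)$ is the least $k\in\mathbb N$ such that for every $\varepsilon>0$ there is a Borel set $A\subseteq X$ with $\mu(A)>1-\varepsilon$ such that the induced subgraph $\mathcal G\restriction A$ has a $\mu$-measurable proper $k$-coloring ($\infty$ if there is no such $k$). (1) Let $f_1,\dots,f_n:X\to X$ be Borel functions, each bounded-to-one (for some $d\in\mathbb N$ all fibers have at most $d$ points), and let $\mathcal G_{f_1,\dots,f_n}$ be the graph on $X$ in which distinct points $x,y$ are adjacent if and only if $f_i(x)=y$ or $f_i(y)=x$ for some $i$. If $\mathcal G_{f_1,\dots,f_n}$ is pmp, then $\chi^{\mathrm{ap}}_\mu(\mathcal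 G_{f_1,\dots,f_n})\le 2n+1$. (2) Equivalently: let $\mathcal D$ be a Borel directed graph on $X$ (its edge set is a Borel subset of $X^2$) and let $\mathcal G$ be its underlying undirected graph, in which distinct $x,y$ are adjacent if and only if $(x,y)$ or $(y,x)$ is an edge of $\mathcal D$. Suppose that there is $d\in\mathbb N$ such that $\mu$-almost every $x$ has at most $d$ neighbors in $\mathcal G$, that $\mu$-almost every $x$ has out-degree at most $n$ in $\mathcal D$, and that $\mathcal G$ is pmp. Then $\chi^{\mathrm{ap}}_\mu(\mathcal G)\le 2n+1$. -/

import Mathlib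

open MeasureTheory

/-- A function all of whose fibers have at most `d` points, for a single natural number `d`. -/
def BoundedToOne {X : Type*} (f : X → X) : Prop :=
  ∃ d : ℕ, ∀ y : X, (f ⁻¹' {y}).encard ≤ d

/-- The (simple, undirected) graph generated by `f₁, …, fₙ`: distinct points `x`, `y` are adjacent
iff `f i x = y` or `f i y = x` for some `i`. -/
def functionGraph {X : Type*} {n : ℕ} (f : Fin n → X → X) : SimpleGraph X where
  Adj x y := x ≠ y ∧ ∃ i, f i x = y ∨ f i y = x
  symm := ⟨fun _ _ h => ⟨h.1.symm, h.2.imp fun _ hi => hi.symm⟩⟩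
  loopless := ⟨fun _ h => h.1 rfl⟩

/-- A directed graph is Borel if its edge set is a Borel subset of `X × X`. -/
def IsBorelDigraph {X : Type*} [MeasurableSpace X] (D : Digraph X) : Prop :=
  MeasurableSet {p : X × X | D.Adj p.1 p.2}

/-- The number of out-neighbors of `x`. -/
noncomputable def outDegree {X : Type*} (D : Digraph X) (x : X) : ℕ∞ :=
  {y : X | D.Adj x y}.encard

/-- A graph has bounded degree (null sets being discarded) if for some natural number `d` almost
every vertex has at most `d` neighbors. -/
def HasBoundedDegree {X : Type*} [MeasurableSpace X] (μ : Measure X) (G : SimpleGraph X) : Prop :=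
  ∃ d : ℕ, ∀ᵐ x ∂μ, (G.neighborSet x).encard ≤ d

/-- The graph `G` is probability-measure-preserving: every partial Borel bijection whose graph is
contained in the connectedness relation of `G` preserves `μ`. A partial Borel bijection is given by
its Borel domain `A` and a Borel map `θ` that is injective on `A` (the values of `θ` outside `A`
play no role); its range is `θ '' A`, which is Borel with Borel inverse map since `X` is standard,
and the preimage of `C ⊆ θ '' A` under it is `A ∩ θ ⁻¹' C`. -/
def IsPMP {X : Type*} [MeasurableSpace X] (μ : Measure X) (G : SimpleGraph X) : Prop :=
  ∀ (A : Set X) (θ : X → X), MeasurableSet A → Measurable θ → Set.InjOn θ A →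
    (∀ x ∈ A, G.Reachable x (θ x)) →
    ∀ C : Set X, NullMeasurableSet C μ → C ⊆ θ '' A → μ (A ∩ θ ⁻¹' C) = μ C

/-- The induced graph on `A` admits a `μ`-measurable proper `k`-coloring. -/
def HasMeasurableColoringOn {X : Type*} [MeasurableSpace X] (μ : Measure X) (G : SimpleGraph X)
    (A : Set X) (k : ℕ) : Prop :=
  ∃ c : (G.induce A).Coloring (Fin k),
    ∀ i : Fin k, NullMeasurableSet {x : X | ∃ hx : x ∈ A, c ⟨x, hx⟩ = i} μ

/-- For each `ε > 0`, there is a Borel set of measure greater than `1 - ε` on which the induced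
graph admits a `μ`-measurable proper `k`-coloring. -/
def IsApproxMeasurablyColorable {X : Type*} [MeasurableSpace X] (μ : Measure X)
    (G : SimpleGraph X) (k : ℕ) : Prop :=
  ∀ ε : ℝ, 0 < ε → ∃ A : Set X, MeasurableSet A ∧ 1 - ε < μ.real A ∧
    HasMeasurableColoringOn μ G A k

/-- The approximate `μ`-measurable chromatic number: the least `k` such that `G` is approximately
`μ`-measurably `k`-colorable, and `⊤` if there is no such natural number. -/
noncomputable def approxMeasurableChromaticNumber {X : Type*} [MeasurableSpace X] (μ : Measure X)
    (G : SimpleGraph X) : ℕ∞ :=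
  ⨅ k ∈ {k : ℕ | IsApproxMeasurablyColorable μ G k}, (k : ℕ∞)

/-! Put `k = 2n + 1`. For Borel `B`, let `B'` be the set of points of `B` with at least `k`
neighbors in `B` (`highDegree`). Every edge inside `B` is directed at least one way. Charging it to
its source costs at most `n` per point, and measure preservation makes edges counted at their
targets cost no more. So the mean degree in `B` is at most `2n`, and Markov's inequality gives `μ B'
≤ 2n / (2n + 1) * μ B` (`mul_measure_highDegree_le`). Iterating from the whole space, the measures
decay geometrically to `0`.

Colors are then assigned in reverse. The last iterate is discarded. Going from `B'` back to `B`,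
every new point has fewer than `k` neighbors in `B`, so a color is always free. The new points are
added one independent set at a time (`measurablyColorableOn_union`), taken from a countable Borel
coloring. Finitely many of these sets suffice up to arbitrarily small measure
(`exists_measurablyColorableOn_of_highDegree`).

Measurability rests on writing the edge relation as finitely many disjoint graphs of injective
partial Borel maps (`exists_injOn_functionDecomposition`). -/

open scoped ENNReal

/-- A presentation of a relation as a finite disjoint union of graphs of partial measurable
functions. -/
structure FunctionDecomposition {X : Type*} [MeasurableSpace X] (R : X → X → Prop) (ι : Type) where
  /-- The domains of the partial functions. -/
  dom : ι → Set X
  /-- The partial functions. -/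
  fn : ι → X → X
  measurableSet_dom : ∀ i, MeasurableSet (dom i)
  measurable_fn : ∀ i, Measurable (fn i)
  rel_iff : ∀ x y, R x y ↔ ∃ i, x ∈ dom i ∧ fn i x = y
  eq_of_fn_eq : ∀ x i j, x ∈ dom i → x ∈ dom j → fn i x = fn j x → i = j

/-! ### Borel enumeration of finite sections -/

section Selection

variable {X : Type*} [MeasurableSpace X] [StandardBorelSpace X]

theorem measurableSet_increasing_tuples {R : X → X → Prop}
    (hR : MeasurableSet {p : X × X | R p.1 p.2}) (d : ℕ) :
    MeasurableSet {p : X × (Fin d → X) |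
      (∀ i, R p.1 (p.2 i)) ∧ StrictMono fun i => embeddingReal X (p.2 i)} := by
  have h1 : ∀ i : Fin d, MeasurableSet {p : X × (Fin d → X) | R p.1 (p.2 i)} := fun i =>
    hR.preimage (f := fun p : X × (Fin d → X) => (p.1, p.2 i)) (by fun_prop)
  have hm : ∀ i : Fin d, Measurable fun p : X × (Fin d → X) => embeddingReal X (p.2 i) := fun i =>
    (measurableEmbedding_embeddingReal X).measurable.comp (by fun_prop)
  have h2 : ∀ i j : Fin d, i < j → MeasurableSet
      {p : X × (Fin d → X) | embeddingReal X (p.2 i) < embeddingReal X (p.2 j)} := fun i j _ =>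
    measurableSet_lt (hm i) (hm j)
  have : {p : X × (Fin d → X) |
      (∀ i, R p.1 (p.2 i)) ∧ StrictMono fun i => embeddingReal X (p.2 i)} =
      (⋂ i, {p : X × (Fin d → X) | R p.1 (p.2 i)}) ∩ ⋂ i, ⋂ j, ⋂ (_ : i < j),
        {p : X × (Fin d → X) | embeddingReal X (p.2 i) < embeddingReal X (p.2 j)} := by
    ext p
    simp [StrictMono]
  rw [this]
  exact (MeasurableSet.iInter h1).inter
    (MeasurableSet.iInter fun i => MeasurableSet.iInter fun j => MeasurableSet.iInter (h2 i j))

/-- Ordering `X` through its embedding in `ℝ` makes the enumeration canonical. The uniqueness clause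
is what makes the projection from tuples to base points injective. -/
theorem exists_increasing_enumeration {s : Set X} {d : ℕ} (hs : s.encard = d) :
    ∃ y : Fin d → X, (∀ i, y i ∈ s) ∧ (StrictMono fun i => embeddingReal X (y i)) ∧
      Set.range y = s ∧
      ∀ z : Fin d → X, (∀ i, z i ∈ s) → (StrictMono fun i => embeddingReal X (z i)) → z = y := by
  let _ : LinearOrder X :=
    LinearOrder.lift' (embeddingReal X) (measurableEmbedding_embeddingReal X).injective
  have hfin : s.Finite := Set.finite_of_encard_eq_coe hs
  have hc : hfin.toFinset.card = d := by
    rw [hfin.encard_eq_coe_toFinset_card] at hs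
    exact_mod_cast hs
  refine ⟨hfin.toFinset.orderEmbOfFin hc, fun i => ?_, ?_, ?_, fun z hz hzm => ?_⟩
  · exact hfin.mem_toFinset.1 (hfin.toFinset.orderEmbOfFin_mem hc i)
  · exact fun i j hij => (hfin.toFinset.orderEmbOfFin hc).strictMono hij
  · simp
  · exact Finset.orderEmbOfFin_unique hc (fun i => by simpa using hz i) fun i j hij => hzm hij

/-- The points with a section of the maximal size `d` form a measurable set on which the sections
are enumerated by measurable functions. -/
theorem exists_measurable_enumeration [Nonempty X] {R : X → X → Prop}
    (hR : MeasurableSet {p : X × X | R p.1 p.2}) {d : ℕ} (hd : ∀ x, {y | R x y}.encard ≤ d) :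
    MeasurableSet {x | {y | R x y}.encard = d} ∧ ∃ g : Fin d → X → X, (∀ i, Measurable (g i)) ∧
      ∀ x, {y | R x y}.encard = d →
        Function.Injective (fun i => g i x) ∧ Set.range (fun i => g i x) = {y | R x y} := by
  set P := {p : X × (Fin d → X) |
      (∀ i, R p.1 (p.2 i)) ∧ StrictMono fun i => embeddingReal X (p.2 i)} with hP
  have hPm : MeasurableSet P := measurableSet_increasing_tuples hR d
  have hcard : ∀ p ∈ P, {y | R p.1 y}.encard = d := by
    intro p hp
    refine le_antisymm (hd _) ?_
    have hinj : Function.Injective p.2 := fun i j hij => hp.2.injective (by simp [hij])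
    calc (d : ℕ∞) = (Set.range p.2).encard := by
          rw [← Set.image_univ, hinj.encard_image]; simp
      _ ≤ _ := Set.encard_le_encard (by rintro _ ⟨i, rfl⟩; exact hp.1 i)
  have hinj : Set.InjOn Prod.fst P := by
    rintro ⟨x, y⟩ hp ⟨x', z⟩ hq (rfl : x = x')
    obtain ⟨w, -, -, -, hw⟩ := exists_increasing_enumeration (hcard _ hp)
    rw [hw y hp.1 hp.2, hw z hq.1 hq.2]
  have himg : {x | {y | R x y}.encard = d} = Prod.fst '' P := by
    ext x
    constructor
    · intro hx
      obtain ⟨y, h1, h2, -⟩ := exists_increasing_enumeration hx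
      exact ⟨(x, y), ⟨h1, h2⟩, rfl⟩
    · rintro ⟨p, hp, rfl⟩
      exact hcard p hp
  -- Lusin–Souslin: an injective Borel image of a Borel set is Borel.
  refine ⟨himg ▸ hPm.image_of_measurable_injOn measurable_fst hinj, ?_⟩
  have : StandardBorelSpace P := hPm.standardBorel
  have hemb : MeasurableEmbedding (fun p : P => p.1.1) :=
    Measurable.measurableEmbedding (by fun_prop) fun p q h => Subtype.ext (hinj p.2 q.2 h)
  have hext : ∀ i : Fin d, ∃ g : X → X, Measurable g ∧ g ∘ (fun p : P => p.1.1) =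
      fun p : P => p.1.2 i := fun i =>
    hemb.exists_measurable_extend (by fun_prop) fun _ => inferInstance
  choose g hgm hg using hext
  refine ⟨g, hgm, fun x hx => ?_⟩
  obtain ⟨y, h1, h2, h3, -⟩ := exists_increasing_enumeration hx
  have hgy : (fun i => g i x) = y := funext fun i => congrFun (hg i) ⟨(x, y), h1, h2⟩
  rw [hgy]
  exact ⟨fun i j hij => h2.injective (by simp [hij]), h3⟩

/-- The Lusin–Novikov theorem for sections of bounded size. -/
theorem exists_functionDecomposition [Nonempty X] (d : ℕ) :
    ∀ R : X → X → Prop, MeasurableSet {p : X × X | R p.1 p.2} →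
      (∀ x, {y | R x y}.encard ≤ d) →
      ∃ (ι : Type) (_ : Fintype ι), Nonempty (FunctionDecomposition R ι) := by
  induction d with
  | zero =>
    intro R _ hd
    refine ⟨Empty, inferInstance, ⟨⟨nofun, nofun, nofun, nofun, fun x y => ?_, nofun⟩⟩⟩
    have : {y | R x y} = ∅ := by simpa using hd x
    have h2 : y ∉ {y | R x y} := by simp [this]
    simpa using h2
  | succ d ih =>
    intro R hR hd
    obtain ⟨hT, g, hgm, hg⟩ := exists_measurable_enumeration hR hd
    set T := {x | {y | R x y}.encard = ((d + 1 : ℕ) : ℕ∞)} with hTdef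
    -- Deleting the sections of maximal size lowers the bound by one; those over `T` are enumerated
    -- by `g`.
    obtain ⟨ι, _, ⟨F⟩⟩ := ih (fun x y => R x y ∧ x ∉ T)
      (hR.inter (hT.compl.preimage measurable_fst)) (fun x => by
        by_cases hx : x ∈ T
        · simp [hx]
        · have h1 : {y | R x y ∧ x ∉ T} = {y | R x y} := by ext; simp [hx]
          rw [h1]
          have h2 : {y | R x y}.encard < ((d + 1 : ℕ) : ℕ∞) := lt_of_le_of_ne (hd x) hx
          rw [Nat.cast_add, Nat.cast_one] at h2
          exact Order.le_of_lt_add_one h2)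
    have hF : ∀ x i, x ∈ F.dom i → x ∉ T := fun x i hi => ((F.rel_iff x _).2 ⟨i, hi, rfl⟩).2
    refine ⟨ι ⊕ Fin (d + 1), inferInstance, ⟨⟨Sum.elim F.dom fun _ => T, Sum.elim F.fn g, ?_, ?_,
      fun x y => ?_, ?_⟩⟩⟩
    · rintro (i | i)
      exacts [F.measurableSet_dom i, hT]
    · rintro (i | i)
      exacts [F.measurable_fn i, hgm i]
    · by_cases hx : x ∈ T
      · have h1 : R x y ↔ y ∈ Set.range fun i => g i x := by rw [(hg x hx).2]; rfl
        have h2 : ∀ i, x ∉ F.dom i := fun i hi => hF x i hi hx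
        simp [h1, h2, hx]
      · have := F.rel_iff x y
        simp only [hx, not_false_eq_true, and_true] at this
        simp [this, hx]
    · rintro x (i | i) (j | j) hi hj hij
      · exact congrArg _ (F.eq_of_fn_eq x i j hi hj hij)
      · exact absurd hj (hF x i hi)
      · exact absurd hi (hF x j hj)
      · exact congrArg _ ((hg x hi).1 hij)

/-- By symmetry each edge is also traversed backwards by some piece. Splitting each domain by the
index of that return piece gives every restricted map a left inverse. -/
theorem exists_injOn_functionDecomposition [Nonempty X] {R : X → X → Prop} {d : ℕ}
    (hR : MeasurableSet {p : X × X | R p.1 p.2}) (hsymm : ∀ x y, R x y → R y x)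
    (hd : ∀ x, {y | R x y}.encard ≤ d) :
    ∃ (ι : Type) (_ : Fintype ι) (F : FunctionDecomposition R ι),
      ∀ i, Set.InjOn (F.fn i) (F.dom i) := by
  obtain ⟨ι, _, ⟨F⟩⟩ := exists_functionDecomposition d R hR hd
  refine ⟨ι × ι, inferInstance, ⟨fun k => {x | x ∈ F.dom k.1 ∧ F.fn k.1 x ∈ F.dom k.2 ∧
    F.fn k.2 (F.fn k.1 x) = x}, fun k => F.fn k.1, fun k => ?_, fun k => F.measurable_fn _,
    fun x y => ⟨fun h => ?_, ?_⟩, ?_⟩, ?_⟩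
  · have h1 := F.measurable_fn k.1
    exact (F.measurableSet_dom _).inter (((F.measurableSet_dom k.2).preimage h1).inter
      (measurableSet_eq_fun ((F.measurable_fn k.2).comp h1) measurable_id))
  · obtain ⟨i, hi, rfl⟩ := (F.rel_iff x y).1 h
    obtain ⟨j, hj, hjx⟩ := (F.rel_iff _ _).1 (hsymm _ _ h)
    exact ⟨(i, j), ⟨hi, hj, hjx⟩, rfl⟩
  · rintro ⟨k, hk, rfl⟩
    exact (F.rel_iff _ _).2 ⟨k.1, hk.1, rfl⟩
  · rintro x ⟨i, j⟩ ⟨i', j'⟩ ⟨hi, hj, hx⟩ ⟨hi', hj', hx'⟩ hij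
    dsimp only at *
    obtain rfl := F.eq_of_fn_eq x i i' hi hi' hij
    rw [F.eq_of_fn_eq _ j j' hj hj' (hx.trans hx'.symm)]
  · rintro ⟨i, j⟩ x ⟨-, -, hx⟩ y ⟨-, -, hy⟩ hxy
    dsimp only at *
    rw [← hx, ← hy, hxy]

end Selection

/-! ### Countable Borel colorings -/

theorem exists_countable_separating_family (X : Type*) [MeasurableSpace X]
    [StandardBorelSpace X] : ∃ U : ℚ × Bool → Set X, (∀ q, MeasurableSet (U q)) ∧
      ∀ x y, x ≠ y → ∃ q, x ∈ U q ∧ y ∉ U q := by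
  have hm := (measurableEmbedding_embeddingReal X).measurable
  have h1 : ∀ q : ℚ, MeasurableSet {x | embeddingReal X x < q} := fun q =>
    measurableSet_lt hm measurable_const
  refine ⟨fun q => bif q.2 then {x | embeddingReal X x < q.1} else {x | embeddingReal X x < q.1}ᶜ,
    ?_, fun x y hxy => ?_⟩
  · rintro ⟨q, _ | _⟩
    exacts [(h1 q).compl, h1 q]
  · rcases lt_or_gt_of_ne ((measurableEmbedding_embeddingReal X).injective.ne hxy) with h | h
    · obtain ⟨q, h1, h2⟩ := exists_rat_btwn h
      exact ⟨(q, true), by simpa using h1, by simpa using h2.le⟩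
    · obtain ⟨q, h1, h2⟩ := exists_rat_btwn h
      exact ⟨(q, false), by simpa using h2.le, by simpa using h1⟩

namespace FunctionDecomposition

variable {X : Type*} [MeasurableSpace X] {R : X → X → Prop} {ι : Type}

theorem measurableSet_mem_dom_fn_mem (F : FunctionDecomposition R ι) {B : Set X}
    (hB : MeasurableSet B) (i : ι) : MeasurableSet {x | x ∈ F.dom i ∧ F.fn i x ∈ B} :=
  (F.measurableSet_dom i).inter (hB.preimage (F.measurable_fn i))

/-- The number of neighbors of `x` in `B`. -/
noncomputable def degreeIn (F : FunctionDecomposition R ι) (B : Set X) (x : X) : ℕ :=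
  {i | x ∈ F.dom i ∧ F.fn i x ∈ B}.ncard

variable [Fintype ι]

/-- A locally finite Borel graph has a countable Borel coloring, given here as a cover by
independent sets. -/
theorem exists_independent_cover [StandardBorelSpace X]
    (F : FunctionDecomposition R ι) (hirr : ∀ x, ¬ R x x) :
    ∃ S : ℕ → Set X, (∀ m, MeasurableSet (S m)) ∧ (∀ m, ∀ x ∈ S m, ∀ y ∈ S m, ¬ R x y) ∧
      ⋃ m, S m = Set.univ := by
  obtain ⟨U, hU, hsep⟩ := exists_countable_separating_family X
  -- The label of `x` at `i` records either that `x` is outside the domain or a set `U q` separating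
  -- `x` from its image. Two points joined by piece `i` cannot share such a label; the color is the
  -- tuple of labels.
  let V : ι → Option (ℚ × Bool) → Set X := fun i o =>
    o.elim (F.dom i)ᶜ fun q => F.dom i ∩ (U q ∩ (F.fn i ⁻¹' U q)ᶜ)
  have hV : ∀ i o, MeasurableSet (V i o) := by
    rintro i (_ | q)
    · exact (F.measurableSet_dom i).compl
    · exact (F.measurableSet_dom i).inter ((hU q).inter ((hU q).preimage (F.measurable_fn i)).compl)
  have hVx : ∀ x i, ∃ o, x ∈ V i o := by
    intro x i
    by_cases hx : x ∈ F.dom i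
    · have hne : x ≠ F.fn i x := fun h => hirr x ((F.rel_iff x x).2 ⟨i, hx, h.symm⟩)
      obtain ⟨q, h1, h2⟩ := hsep _ _ hne
      exact ⟨some q, hx, h1, h2⟩
    · exact ⟨none, hx⟩
  obtain ⟨e, he⟩ := exists_surjective_nat (ι → Option (ℚ × Bool))
  refine ⟨fun m => ⋂ i, V i (e m i), fun m => MeasurableSet.iInter fun i => hV _ _, ?_, ?_⟩
  · intro m x hx y hy hxy
    obtain ⟨i, hi, rfl⟩ := (F.rel_iff x y).1 hxy
    have h1 := Set.mem_iInter.1 hx i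
    have h2 := Set.mem_iInter.1 hy i
    cases ho : e m i with
    | none => rw [ho] at h1; exact h1 hi
    | some q => rw [ho] at h1 h2; exact h1.2.2 h2.2.1
  · refine Set.eq_univ_of_forall fun x => ?_
    choose o ho using hVx x
    obtain ⟨m, rfl⟩ := he o
    exact Set.mem_iUnion.2 ⟨m, Set.mem_iInter.2 ho⟩

end FunctionDecomposition

/-! ### Double counting for finite families of sets -/

/-- The number of members of a finite family containing a point is a measurable function. -/
theorem measurable_ncard_mem {X ι : Type*} [MeasurableSpace X] [Fintype ι] {T : ι → Set X}
    (hT : ∀ i, MeasurableSet (T i)) : Measurable fun x => {i | x ∈ T i}.ncard := by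
  classical
  have h : ∀ x, {i | x ∈ T i}.ncard = ∑ i, if x ∈ T i then 1 else 0 := fun x => by
    rw [Set.ncard_eq_toFinset_card', ← Finset.card_filter]
    congr 1
    ext; simp
  simp_rw [h]
  exact Finset.measurable_sum _ fun i _ =>
    Measurable.ite (hT i) measurable_const measurable_const

theorem lintegral_ncard_mem {X ι : Type*} [MeasurableSpace X] [Fintype ι] {T : ι → Set X}
    (hT : ∀ i, MeasurableSet (T i)) (μ : Measure X) :
    ∫⁻ x, ({i | x ∈ T i}.ncard : ℝ≥0∞) ∂μ = ∑ i, μ (T i) := by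
  classical
  have h : ∀ x, ({i | x ∈ T i}.ncard : ℝ≥0∞) = ∑ i, (T i).indicator 1 x := fun x => by
    rw [Set.ncard_eq_toFinset_card']
    simp [Set.indicator_apply]
  simp_rw [h]
  rw [lintegral_finsetSum _ fun i _ => measurable_one.indicator (hT i)]
  exact Finset.sum_congr rfl fun i _ => lintegral_indicator_one (hT i)

theorem sum_measure_le {X ι : Type*} [MeasurableSpace X] [Fintype ι] {T : ι → Set X}
    (hT : ∀ i, MeasurableSet (T i)) (μ : Measure X) {B : Set X} (hB : MeasurableSet B) {n : ℕ}
    (hTB : ∀ i, T i ⊆ B) (hn : ∀ x ∈ B, {i | x ∈ T i}.ncard ≤ n) :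
    ∑ i, μ (T i) ≤ n * μ B := by
  rw [← lintegral_ncard_mem hT, ← lintegral_indicator_const hB]
  refine lintegral_mono fun x => ?_
  by_cases hx : x ∈ B
  · simpa [hx] using hn x hx
  · have : {i | x ∈ T i} = ∅ := Set.eq_empty_of_forall_notMem fun i hi => hx (hTB i hi)
    simp [this]

theorem mul_measure_le_sum {X ι : Type*} [MeasurableSpace X] [Fintype ι] {T : ι → Set X}
    (hT : ∀ i, MeasurableSet (T i)) (μ : Measure X) {B : Set X} (hB : MeasurableSet B) {n : ℕ}
    (hn : ∀ x ∈ B, n ≤ {i | x ∈ T i}.ncard) :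
    n * μ B ≤ ∑ i, μ (T i) := by
  rw [← lintegral_ncard_mem hT, ← lintegral_indicator_const hB]
  refine lintegral_mono fun x => ?_
  by_cases hx : x ∈ B
  · simpa [hx] using hn x hx
  · simp [hx]

/-! ### Greedy coloring -/

/-- A measurable proper coloring, with colors below `k`, of the relation `R` restricted to `B`. -/
def MeasurablyColorableOn {X : Type*} [MeasurableSpace X] (R : X → X → Prop) (k : ℕ)
    (B : Set X) : Prop :=
  ∃ c : X → ℕ, Measurable c ∧ (∀ x ∈ B, c x < k) ∧ ∀ x ∈ B, ∀ y ∈ B, R x y → c x ≠ c y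

namespace FunctionDecomposition

variable {X : Type*} [MeasurableSpace X] {R : X → X → Prop} {ι : Type} [Fintype ι]

theorem measurable_degreeIn (F : FunctionDecomposition R ι) {B : Set X} (hB : MeasurableSet B) :
    Measurable (F.degreeIn B) :=
  measurable_ncard_mem (F.measurableSet_mem_dom_fn_mem hB)

theorem degreeIn_mono (F : FunctionDecomposition R ι) {B C : Set X} (h : B ⊆ C) (x : X) :
    F.degreeIn B x ≤ F.degreeIn C x :=
  Set.ncard_le_ncard (fun _ hi => ⟨hi.1, h hi.2⟩) (Set.toFinite _)

/-- Greedy extension of a coloring to an independent set of vertices of small degree. -/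
theorem measurablyColorableOn_union (F : FunctionDecomposition R ι)
    (hsymm : ∀ x y, R x y → R y x) {k : ℕ} {B S : Set X} (hB : MeasurableSet B)
    (hS : MeasurableSet S) (hBc : MeasurablyColorableOn R k B)
    (hind : ∀ x ∈ S, ∀ y ∈ S, ¬ R x y) (hdeg : ∀ x ∈ S, F.degreeIn B x < k) :
    MeasurablyColorableOn R k (B ∪ S) := by
  classical
  obtain ⟨c, hc, hck, hcR⟩ := hBc
  let used : X → ℕ → Prop := fun x m => ∃ i, x ∈ F.dom i ∧ F.fn i x ∈ B ∧ c (F.fn i x) = m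
  have hused : ∀ m, MeasurableSet {x | used x m} := fun m => by
    have : {x | used x m} = ⋃ i, F.dom i ∩ (F.fn i ⁻¹' (B ∩ c ⁻¹' {m})) := by
      ext x; simp [used]
    rw [this]
    exact MeasurableSet.iUnion fun i => (F.measurableSet_dom i).inter
      ((hB.inter (hc (measurableSet_singleton m))).preimage (F.measurable_fn i))
  have hfree : ∀ x ∈ S, ∃ m, m < k ∧ ¬ used x m := by
    intro x hx
    by_contra! hcon
    have h1 : (Finset.range k : Set ℕ) ⊆
        (fun i => c (F.fn i x)) '' {i | x ∈ F.dom i ∧ F.fn i x ∈ B} := by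
      intro m hm
      obtain ⟨i, h1, h2, h3⟩ := hcon m (by simpa using hm)
      exact ⟨i, ⟨h1, h2⟩, h3⟩
    have h2 := (Set.ncard_le_ncard h1 (Set.toFinite _)).trans (Set.ncard_image_le (Set.toFinite _))
    rw [Set.ncard_coe_finset, Finset.card_range] at h2
    exact absurd (hdeg x hx) (not_lt.2 h2)
  -- The last disjunct only makes `p` total, so that the least admissible color is defined
  -- everywhere and measurable.
  let p : X → ℕ → Prop := fun x m => (x ∈ B ∧ c x = m) ∨ (x ∉ B ∧ x ∈ S ∧ m < k ∧ ¬ used x m) ∨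
    (x ∉ B ∧ x ∉ S)
  have hp : ∀ x, ∃ m, p x m := by
    intro x
    by_cases hxB : x ∈ B
    · exact ⟨c x, Or.inl ⟨hxB, rfl⟩⟩
    · by_cases hxS : x ∈ S
      · obtain ⟨m, hm⟩ := hfree x hxS
        exact ⟨m, Or.inr (Or.inl ⟨hxB, hxS, hm⟩)⟩
      · exact ⟨0, Or.inr (Or.inr ⟨hxB, hxS⟩)⟩
  have hpm : ∀ m, MeasurableSet {x | p x m} := fun m =>
    (hB.inter (hc (measurableSet_singleton m))).union ((hB.compl.inter (hS.inter
      ((MeasurableSet.const _).inter (hused m).compl))).union (hB.compl.inter hS.compl))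
  have hspec : ∀ x, p x (Nat.find (hp x)) := fun x => Nat.find_spec (hp x)
  have hcB : ∀ x ∈ B, Nat.find (hp x) = c x := by
    intro x hx
    rcases hspec x with h | h | h
    exacts [h.2.symm, absurd hx h.1, absurd hx h.1]
  have hcS : ∀ x ∈ S, x ∉ B → Nat.find (hp x) < k ∧ ¬ used x (Nat.find (hp x)) := by
    intro x hx hxB
    rcases hspec x with h | h | h
    exacts [absurd h.1 hxB, h.2.2, absurd hx h.2]
  have hcross : ∀ x ∈ S, x ∉ B → ∀ y ∈ B, R x y → Nat.find (hp x) ≠ Nat.find (hp y) := by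
    intro x hx hxB y hy hxy h
    obtain ⟨i, hi, rfl⟩ := (F.rel_iff x y).1 hxy
    exact (hcS x hx hxB).2 ⟨i, hi, hy, by rw [h, hcB _ hy]⟩
  refine ⟨fun x => Nat.find (hp x), measurable_find hp hpm, ?_, ?_⟩
  · intro x hx
    by_cases hxB : x ∈ B
    · simpa only [hcB x hxB] using hck x hxB
    · exact (hcS x (hx.resolve_left hxB) hxB).1
  · intro x hx y hy hxy
    by_cases hxB : x ∈ B
    · by_cases hyB : y ∈ B
      · simpa only [hcB x hxB, hcB y hyB] using hcR x hxB y hyB hxy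
      · exact (hcross y (hy.resolve_left hyB) hyB x hxB (hsymm _ _ hxy)).symm
    · by_cases hyB : y ∈ B
      · exact hcross x (hx.resolve_left hxB) hxB y hyB hxy
      · exact absurd hxy (hind x (hx.resolve_left hxB) y (hy.resolve_left hyB))

/-- If the part of `B` consisting of vertices of large degree can be colored up to measure `δ`,
then so can `B`. -/
theorem exists_measurablyColorableOn_of_highDegree (F : FunctionDecomposition R ι)
    [StandardBorelSpace X] (μ : Measure X) [IsFiniteMeasure μ]
    (hsymm : ∀ x y, R x y → R y x) (hirr : ∀ x, ¬ R x x) {k : ℕ} {B : Set X}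
    (hB : MeasurableSet B) {δ : ℝ≥0∞}
    (h : ∀ r > δ, ∃ C ⊆ {x ∈ B | k ≤ F.degreeIn B x}, MeasurableSet C ∧
      MeasurablyColorableOn R k C ∧ μ ({x ∈ B | k ≤ F.degreeIn B x} \ C) < r) :
    ∀ r > δ, ∃ C ⊆ B, MeasurableSet C ∧ MeasurablyColorableOn R k C ∧ μ (B \ C) < r := by
  intro r hr
  -- The slack `r - r'` pays for the low-degree points missed by finitely many independent sets.
  obtain ⟨r', hr', hr'r⟩ := exists_between hr
  obtain ⟨C, hCB, hC, hCc, hCμ⟩ := h r' hr'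
  obtain ⟨S, hS, hSind, hSu⟩ := F.exists_independent_cover hirr
  set L := {x ∈ B | F.degreeIn B x < k} with hLdef
  have hL : MeasurableSet L :=
    hB.inter (measurableSet_lt (F.measurable_degreeIn hB) measurable_const)
  let K : ℕ → Set X := fun m => C ∪ ⋃ j ∈ Finset.range m, L ∩ S j
  have hKs : ∀ m, K (m + 1) = K m ∪ (L ∩ S m) := by
    intro m
    ext x
    simp only [K, Set.mem_union, Set.mem_iUnion, Finset.mem_range, Nat.lt_succ_iff_lt_or_eq,
      Set.mem_inter_iff, exists_prop]
    constructor
    · rintro (h | ⟨j, h | rfl, h'⟩)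
      exacts [.inl (.inl h), .inl (.inr ⟨j, h, h'⟩), .inr h']
    · rintro ((h | ⟨j, h, h'⟩) | h)
      exacts [.inl h, .inr ⟨j, .inl h, h'⟩, .inr ⟨m, .inr rfl, h⟩]
  have hKm : ∀ m, MeasurableSet (K m) := fun m =>
    hC.union (Finset.measurableSet_biUnion _ fun j _ => hL.inter (hS j))
  have hKB : ∀ m, K m ⊆ B := fun m => Set.union_subset (hCB.trans (Set.sep_subset _ _))
    (Set.iUnion₂_subset fun j _ => Set.inter_subset_left.trans (Set.sep_subset _ _))
  have hKc : ∀ m, MeasurablyColorableOn R k (K m) := by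
    intro m
    induction m with
    | zero => simpa [K] using hCc
    | succ m ih =>
      rw [hKs]
      exact F.measurablyColorableOn_union hsymm (hKm m) (hL.inter (hS m)) ih
        (fun x hx y hy => hSind m x hx.2 y hy.2)
        fun x hx => (F.degreeIn_mono (hKB m) x).trans_lt hx.1.2
  let W : ℕ → Set X := fun m => L \ ⋃ j ∈ Finset.range m, S j
  have hW : Filter.Tendsto (fun m => μ (W m)) Filter.atTop (nhds 0) := by
    have hanti : Antitone W := fun a b hab => Set.sdiff_subset_sdiff_right
      (Set.biUnion_subset_biUnion_left fun j hj => by simp at hj ⊢; omega)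
    have hinter : ⋂ m, W m = ∅ := by
      refine Set.eq_empty_of_forall_notMem fun x hx => ?_
      obtain ⟨j, hj⟩ := Set.mem_iUnion.1 (hSu ▸ Set.mem_univ x)
      exact (Set.mem_iInter.1 hx (j + 1)).2 (Set.mem_biUnion (by simp) hj)
    have := tendsto_measure_iInter_atTop (μ := μ) (s := W)
      (fun m => (hL.diff (Finset.measurableSet_biUnion _ fun j _ => hS j)).nullMeasurableSet)
      hanti ⟨0, measure_ne_top _ _⟩
    rwa [hinter, measure_empty] at this
  obtain ⟨m, hm⟩ := ((tendsto_order.1 hW).2 (r - r') (tsub_pos_of_lt hr'r)).exists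
  refine ⟨K m, hKB m, hKm m, hKc m, ?_⟩
  calc μ (B \ K m) ≤ μ (({x ∈ B | k ≤ F.degreeIn B x} \ C) ∪ W m) := by
        refine measure_mono fun x hx => ?_
        simp only [K, W, hLdef, Set.mem_union, Set.mem_sdiff, Set.mem_iUnion, Set.mem_inter_iff,
          Set.mem_ofPred_eq, exists_prop, not_or, not_exists, not_and] at hx ⊢
        by_cases hk : k ≤ F.degreeIn B x
        · exact .inl ⟨⟨hx.1, hk⟩, hx.2.1⟩
        · exact .inr ⟨⟨hx.1, not_le.1 hk⟩, fun j hj => hx.2.2 j hj ⟨hx.1, not_le.1 hk⟩⟩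
    _ ≤ _ := measure_union_le _ _
    _ < r' + (r - r') := ENNReal.add_lt_add hCμ hm
    _ = r := add_tsub_cancel_of_le hr'r.le

end FunctionDecomposition

/-! ### Mass transport and geometric decay -/

theorem ncard_le_of_injOn_mapsTo {ι X : Type*} [Finite ι] {s : Set ι} {t : Set X} {n : ℕ}
    (ht : t.encard ≤ n) (f : ι → X) (hf : Set.InjOn f s) (hst : ∀ i ∈ s, f i ∈ t) :
    s.ncard ≤ n := by
  have h : (s.ncard : ℕ∞) ≤ n := by
    rw [(Set.toFinite s).cast_ncard_eq, ← hf.encard_image]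
    exact (Set.encard_le_encard (Set.image_subset_iff.2 hst)).trans ht
  exact_mod_cast h

namespace FunctionDecomposition

variable {X : Type*} [MeasurableSpace X] {R : X → X → Prop} {ι : Type} [Fintype ι]

/-- The points of `B` with at least `k` neighbors in `B`. -/
def highDegree (F : FunctionDecomposition R ι) (k : ℕ) (B : Set X) : Set X :=
  {x ∈ B | k ≤ F.degreeIn B x}

theorem measurableSet_highDegree (F : FunctionDecomposition R ι) (k : ℕ) {B : Set X}
    (hB : MeasurableSet B) : MeasurableSet (F.highDegree k B) :=
  hB.inter (measurableSet_le measurable_const (F.measurable_degreeIn hB))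

/-- By mass transport, the average degree is at most twice the maximal out-degree. -/
theorem mul_measure_highDegree_le [StandardBorelSpace X] [Nonempty X]
    (F : FunctionDecomposition R ι) (hinj : ∀ i, Set.InjOn (F.fn i) (F.dom i)) {μ : Measure X}
    (hμ : ∀ i A, MeasurableSet A → A ⊆ F.dom i → μ (F.fn i '' A) = μ A)
    {out : X → X → Prop} (hout : MeasurableSet {p : X × X | out p.1 p.2})
    (hsymm : ∀ x y, R x y → R y x) (hRout : ∀ x y, R x y → out x y ∨ out y x) {n : ℕ}
    (hn : ∀ x, {y | R x y ∧ out x y}.encard ≤ n) (k : ℕ) {B : Set X} (hB : MeasurableSet B) :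
    k * μ (F.highDegree k B) ≤ 2 * n * μ B := by
  let T : ι → Set X := fun i => B ∩ {x | x ∈ F.dom i ∧ F.fn i x ∈ B}
  let O : ι → Set X := fun i => T i ∩ {x | out x (F.fn i x)}
  let I : ι → Set X := fun i => T i ∩ {x | out (F.fn i x) x}
  have hT : ∀ i, MeasurableSet (T i) := fun i => hB.inter (F.measurableSet_mem_dom_fn_mem hB i)
  have hO : ∀ i, MeasurableSet (O i) := fun i =>
    (hT i).inter (hout.preimage (measurable_id.prodMk (F.measurable_fn i)))
  have hI : ∀ i, MeasurableSet (I i) := fun i =>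
    (hT i).inter (hout.preimage ((F.measurable_fn i).prodMk measurable_id))
  have hIdom : ∀ i, I i ⊆ F.dom i := fun i x hx => hx.1.2.1
  -- Edges pointing into `x` are counted at their other endpoint; this is the only use of measure
  -- preservation.
  have hTle : ∀ i, μ (T i) ≤ μ (O i) + μ (F.fn i '' I i) := fun i => by
    rw [hμ i (I i) (hI i) (hIdom i)]
    refine (measure_mono fun x hx => ?_).trans (measure_union_le _ _)
    exact (hRout x _ ((F.rel_iff _ _).2 ⟨i, hx.2.1, rfl⟩)).imp (⟨hx, ·⟩) (⟨hx, ·⟩)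
  have h1 : ∑ i, μ (O i) ≤ n * μ B := by
    refine sum_measure_le hO μ hB (fun i x hx => hx.1.1) fun x _ => ?_
    exact ncard_le_of_injOn_mapsTo (hn x) (fun i => F.fn i x)
      (fun i hi j hj hij => F.eq_of_fn_eq x i j hi.1.2.1 hj.1.2.1 hij)
      fun i hi => ⟨(F.rel_iff _ _).2 ⟨i, hi.1.2.1, rfl⟩, hi.2⟩
  have h2 : ∑ i, μ (F.fn i '' I i) ≤ n * μ B := by
    refine sum_measure_le (fun i => (hI i).image_of_measurable_injOn (F.measurable_fn i)
      ((hinj i).mono (hIdom i))) μ hB (fun i => ?_) fun y _ => ?_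
    · rintro _ ⟨x, hx, rfl⟩
      exact hx.1.2.2
    -- The preimages of `y` under different pieces are distinct out-neighbors of `y`, by
    -- disjointness of the pieces.
    · have hex : ∀ i ∈ {i | y ∈ F.fn i '' I i}, ∃ x, x ∈ I i ∧ F.fn i x = y := fun i hi => hi
      choose! f hfI hfy using hex
      refine ncard_le_of_injOn_mapsTo (hn y) f (fun i hi j hj hij => ?_) fun i hi => ?_
      · refine F.eq_of_fn_eq (f i) i j (hIdom i (hfI i hi)) (hij ▸ hIdom j (hfI j hj)) ?_
        rw [hfy i hi, hij, hfy j hj]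
      · refine ⟨hsymm _ _ ((F.rel_iff _ _).2 ⟨i, hIdom i (hfI i hi), hfy i hi⟩), ?_⟩
        have := (hfI i hi).2
        rwa [Set.mem_ofPred_eq, hfy i hi] at this
  calc k * μ (F.highDegree k B) ≤ ∑ i, μ (T i) := by
        refine mul_measure_le_sum hT μ (F.measurableSet_highDegree k hB) fun x hx => ?_
        have : {i | x ∈ T i} = {i | x ∈ F.dom i ∧ F.fn i x ∈ B} := by
          ext i
          exact and_iff_right hx.1
        rw [this]
        exact hx.2
    _ ≤ ∑ i, μ (O i) + ∑ i, μ (F.fn i '' I i) := by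
        rw [← Finset.sum_add_distrib]
        exact Finset.sum_le_sum fun i _ => hTle i
    _ ≤ n * μ B + n * μ B := add_le_add h1 h2
    _ = 2 * n * μ B := by ring

theorem exists_measurablyColorableOn_of_iterate_highDegree [StandardBorelSpace X]
    (F : FunctionDecomposition R ι) (μ : Measure X) [IsFiniteMeasure μ]
    (hsymm : ∀ x y, R x y → R y x) (hirr : ∀ x, ¬ R x x) (k j : ℕ) :
    ∀ B : Set X, MeasurableSet B → ∀ r > μ ((F.highDegree k)^[j] B),
      ∃ C ⊆ B, MeasurableSet C ∧ MeasurablyColorableOn R k C ∧ μ (B \ C) < r := by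
  induction j with
  | zero =>
    intro B _ r hr
    -- The last iterate is left uncolored.
    exact ⟨∅, Set.empty_subset _, MeasurableSet.empty, ⟨fun _ => 0, measurable_const, by simp,
      by simp⟩, by simpa using hr⟩
  | succ j ih =>
    intro B hB
    exact F.exists_measurablyColorableOn_of_highDegree μ hsymm hirr hB
      (ih _ (F.measurableSet_highDegree k hB))

theorem exists_measurablyColorableOn [StandardBorelSpace X]
    (F : FunctionDecomposition R ι) (hinj : ∀ i, Set.InjOn (F.fn i) (F.dom i)) {μ : Measure X}
    [IsProbabilityMeasure μ]
    (hμ : ∀ i A, MeasurableSet A → A ⊆ F.dom i → μ (F.fn i '' A) = μ A)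
    {out : X → X → Prop} (hout : MeasurableSet {p : X × X | out p.1 p.2})
    (hsymm : ∀ x y, R x y → R y x) (hirr : ∀ x, ¬ R x x)
    (hRout : ∀ x y, R x y → out x y ∨ out y x) {n : ℕ}
    (hn : ∀ x, {y | R x y ∧ out x y}.encard ≤ n) {r : ℝ≥0∞} (hr : 0 < r) :
    ∃ C, MeasurableSet C ∧ MeasurablyColorableOn R (2 * n + 1) C ∧ μ Cᶜ < r := by
  have := nonempty_of_isProbabilityMeasure μ
  set q : ℝ≥0∞ := 2 * n / ((2 * n + 1 : ℕ) : ℝ≥0∞) with hq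
  have hq1 : q < 1 := by
    refine ENNReal.div_lt_of_lt_mul ?_
    rw [one_mul]
    exact_mod_cast Nat.lt_succ_self (2 * n)
  have hstep : ∀ B, MeasurableSet B → μ (F.highDegree (2 * n + 1) B) ≤ q * μ B := by
    intro B hB
    have h : q * μ B = 2 * n * μ B / ((2 * n + 1 : ℕ) : ℝ≥0∞) := by
      rw [hq, div_eq_mul_inv, div_eq_mul_inv]
      ring
    rw [h, ENNReal.le_div_iff_mul_le (.inl (by simp)) (.inl (ENNReal.natCast_ne_top _)), mul_comm]
    exact F.mul_measure_highDegree_le hinj hμ hout hsymm hRout hn _ hB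
  have hiter : ∀ j, MeasurableSet ((F.highDegree (2 * n + 1))^[j] Set.univ) ∧
      μ ((F.highDegree (2 * n + 1))^[j] Set.univ) ≤ q ^ j := by
    intro j
    induction j with
    | zero => simp
    | succ j ih =>
      rw [Function.iterate_succ_apply']
      refine ⟨F.measurableSet_highDegree _ ih.1, (hstep _ ih.1).trans ?_⟩
      rw [pow_succ']
      gcongr
      exact ih.2
  obtain ⟨j, hj⟩ :=
    ((tendsto_order.1 (ENNReal.tendsto_pow_atTop_nhds_zero_of_lt_one hq1)).2 r hr).exists
  obtain ⟨C, -, hC, hCc, hCr⟩ := F.exists_measurablyColorableOn_of_iterate_highDegree μ hsymm hirr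
    (2 * n + 1) j Set.univ MeasurableSet.univ r ((hiter j).2.trans_lt hj)
  exact ⟨C, hC, hCc, by rwa [Set.compl_eq_univ_sdiff]⟩

end FunctionDecomposition

/-! ### From relations back to graphs -/

theorem isApproxMeasurablyColorable_toSimpleGraphInclusive {X : Type*} [MeasurableSpace X]
    [StandardBorelSpace X] {μ : Measure X} [IsProbabilityMeasure μ] {n : ℕ} {D : Digraph X}
    (hD : IsBorelDigraph D) (hdeg : HasBoundedDegree μ D.toSimpleGraphInclusive)
    (hout : ∀ᵐ x ∂μ, outDegree D x ≤ n) (hpmp : IsPMP μ D.toSimpleGraphInclusive) :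
    IsApproxMeasurablyColorable μ D.toSimpleGraphInclusive (2 * n + 1) := by
  have := nonempty_of_isProbabilityMeasure μ
  intro ε hε
  obtain ⟨d, hd⟩ := hdeg
  obtain ⟨Y, hYμ, hY, hYd⟩ := (hd.and hout).exists_measurable_mem
  set G := D.toSimpleGraphInclusive
  have hGm : MeasurableSet {p : X × X | G.Adj p.1 p.2} :=
    (measurableSet_diagonal.compl).inter (hD.union (hD.preimage measurable_swap))
  -- Keeping only edges inside the conull set `Y` makes the degree bounds hold everywhere and the
  -- relation stay symmetric.
  let R : X → X → Prop := fun x y => x ∈ Y ∧ y ∈ Y ∧ G.Adj x y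
  have hRm : MeasurableSet {p : X × X | R p.1 p.2} :=
    (hY.preimage measurable_fst).inter ((hY.preimage measurable_snd).inter hGm)
  have hsymm : ∀ x y, R x y → R y x := fun x y h => ⟨h.2.1, h.1, h.2.2.symm⟩
  have hRd : ∀ x, {y | R x y}.encard ≤ d := fun x => by
    by_cases hx : x ∈ Y
    · exact (Set.encard_le_encard fun y hy => hy.2.2).trans (hYd x hx).1
    · simp [R, hx]
  have hRn : ∀ x, {y | R x y ∧ D.Adj x y}.encard ≤ n := fun x => by
    by_cases hx : x ∈ Y
    · exact (Set.encard_le_encard fun y hy => hy.2).trans (hYd x hx).2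
    · simp [R, hx]
  obtain ⟨ι, _, F, hinj⟩ := exists_injOn_functionDecomposition hRm hsymm hRd
  have hμ : ∀ i A, MeasurableSet A → A ⊆ F.dom i → μ (F.fn i '' A) = μ A := by
    intro i A hA hAi
    have hA' := (hinj i).mono hAi
    -- The pmp condition is applied with `C` the full image of `A`.
    rw [← hpmp A (F.fn i) hA (F.measurable_fn i) hA'
      (fun x hx => ((F.rel_iff x _).2 ⟨i, hAi hx, rfl⟩).2.2.reachable) (F.fn i '' A)
      (hA.image_of_measurable_injOn (F.measurable_fn i) hA').nullMeasurableSet subset_rfl,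
      Set.inter_eq_left.2 (Set.subset_preimage_image _ _)]
  obtain ⟨C, hC, ⟨c, hc, hck, hcR⟩, hCε⟩ := F.exists_measurablyColorableOn hinj hμ hD hsymm
    (fun x h => G.loopless.irrefl x h.2.2) (fun x y h => h.2.2.2) hRn
    (ENNReal.ofReal_pos.2 hε)
  refine ⟨C ∩ Y, hC.inter hY, ?_, ⟨fun x => ⟨c x, hck x x.2.1⟩, fun {x y} hxy h => ?_⟩, fun i => ?_⟩
  · have h1 : μ.real (C ∩ Y) = μ.real C := measureReal_congr (inter_ae_eq_left_of_ae_eq_univ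
      (Filter.eventuallyEq_univ.2 hYμ))
    have h2 : μ.real Cᶜ < ε := (ENNReal.lt_ofReal_iff_toReal_lt (measure_ne_top _ _)).1 hCε
    rw [probReal_compl_eq_one_sub hC] at h2
    linarith
  · exact hcR x x.2.1 y y.2.1 ⟨x.2.2, y.2.2, hxy⟩ (congrArg Fin.val h)
  · have : {x : X | ∃ hx : x ∈ C ∩ Y, (⟨c x, hck x hx.1⟩ : Fin (2 * n + 1)) = i} =
        (C ∩ Y) ∩ c ⁻¹' {i.1} := by
      ext x
      constructor
      · rintro ⟨hx, h⟩
        exact ⟨hx, congrArg Fin.val h⟩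
      · rintro ⟨hx, h⟩
        exact ⟨hx, Fin.ext h⟩
    exact (this ▸ (hC.inter hY).inter (hc (measurableSet_singleton _))).nullMeasurableSet

/-- The directed graph with an edge from `x` to each `f i x`. -/
def functionDigraph {X ι : Type*} (f : ι → X → X) : Digraph X where
  Adj x y := ∃ i, f i x = y

theorem toSimpleGraphInclusive_functionDigraph {X : Type*} {n : ℕ} (f : Fin n → X → X) :
    (functionDigraph f).toSimpleGraphInclusive = functionGraph f := by
  ext x y
  exact and_congr_right fun _ => exists_or.symm

theorem outDegree_functionDigraph_le {X : Type*} {n : ℕ} (f : Fin n → X → X) (x : X) :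
    outDegree (functionDigraph f) x ≤ n := by
  have : {y | (functionDigraph f).Adj x y} = (fun i => f i x) '' Set.univ := by
    ext y
    simp [functionDigraph]
  rw [outDegree, this]
  exact (Set.encard_image_le _ _).trans (by simp)

theorem isBorelDigraph_functionDigraph {X : Type*} [MeasurableSpace X] [StandardBorelSpace X]
    {n : ℕ} {f : Fin n → X → X} (hf : ∀ i, Measurable (f i)) :
    IsBorelDigraph (functionDigraph f) := by
  have : {p : X × X | (functionDigraph f).Adj p.1 p.2} = ⋃ i, {p : X × X | f i p.1 = p.2} := by
    ext p
    simp [functionDigraph]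
  rw [IsBorelDigraph, this]
  exact MeasurableSet.iUnion fun i =>
    measurableSet_eq_fun ((hf i).comp measurable_fst) measurable_snd

theorem hasBoundedDegree_functionGraph {X : Type*} [MeasurableSpace X] (μ : Measure X) {n : ℕ}
    {f : Fin n → X → X} (hf : ∀ i, BoundedToOne (f i)) :
    HasBoundedDegree μ (functionGraph f) := by
  choose d hd using hf
  refine ⟨n + ∑ i, d i, Filter.Eventually.of_forall fun x => ?_⟩
  have hsub : (functionGraph f).neighborSet x ⊆
      {y | (functionDigraph f).Adj x y} ∪ ⋃ i, f i ⁻¹' {x} := by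
    rintro y ⟨-, i, hi | hi⟩
    · exact .inl ⟨i, hi⟩
    · exact .inr (by simpa using ⟨i, hi⟩)
  push_cast
  exact (Set.encard_le_encard hsub).trans ((Set.encard_union_le _ _).trans
    (add_le_add (outDegree_functionDigraph_le f x)
      ((Set.encard_iUnion_le_of_fintype _).trans (Finset.sum_le_sum fun i _ => hd i x))))

theorem approxMeasurableChromaticNumber_le {X : Type*} [MeasurableSpace X] {μ : Measure X}
    {G : SimpleGraph X} {k : ℕ} (h : IsApproxMeasurablyColorable μ G k) :
    approxMeasurableChromaticNumber μ G ≤ k :=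
  iInf₂_le k h

theorem theorem5p5 {X : Type*} [MeasurableSpace X] [StandardBorelSpace X]
    (μ : Measure X) [IsProbabilityMeasure μ] (n : ℕ) :
    (∀ f : Fin n → X → X, (∀ i, Measurable (f i)) → (∀ i, BoundedToOne (f i)) →
      IsPMP μ (functionGraph f) →
      approxMeasurableChromaticNumber μ (functionGraph f) ≤ 2 * (n : ℕ∞) + 1) ∧
    (∀ D : Digraph X, IsBorelDigraph D → HasBoundedDegree μ D.toSimpleGraphInclusive →
      (∀ᵐ x ∂μ, outDegree D x ≤ n) → IsPMP μ D.toSimpleGraphInclusive →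
      approxMeasurableChromaticNumber μ D.toSimpleGraphInclusive ≤ 2 * (n : ℕ∞) + 1) := by
  have key : ∀ D : Digraph X, IsBorelDigraph D → HasBoundedDegree μ D.toSimpleGraphInclusive →
      (∀ᵐ x ∂μ, outDegree D x ≤ n) → IsPMP μ D.toSimpleGraphInclusive →
      approxMeasurableChromaticNumber μ D.toSimpleGraphInclusive ≤ 2 * (n : ℕ∞) + 1 :=
    fun D hD hdeg hout hpmp => by
      exact_mod_cast approxMeasurableChromaticNumber_le
        (isApproxMeasurablyColorable_toSimpleGraphInclusive hD hdeg hout hpmp)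
  refine ⟨fun f hf hfb hpmp => ?_, key⟩
  have h := toSimpleGraphInclusive_functionDigraph f
  rw [← h] at hpmp ⊢
  exact key _ (isBorelDigraph_functionDigraph hf) (h ▸ hasBoundedDegree_functionGraph μ hfb)
    (Filter.Eventually.of_forall (outDegree_functionDigraph_le f)) hpmp
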